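/- **Theorem.** A set $Z\subseteq\mathbb N$ is *dense simple* if it is recursively enumerable (r.e.), has infinite complement, and the enumeration $a_0<a_1<\cdots$ of $\mathbb N\setminus Z$ dominates every recursive function $f$, i.e. $f(n)<a_n$ for all but finitely many $n$. Let $Z$ be any dense simple set with $0\notin Z$, and put $x\,\zeta\,y$ iff there is an $n$ with $a_n\le\min\{x,y\}\le\max\{x,y\}<a_{n+1}$. Then $\zeta$ is a positive (i.e. r.e.) equivalence relation on $\mathbb N$ with infinitely many classes, and 1. there is a confidently learnable $\zeta$-family; 2. no $\zeta$-family is finitely learnable. Here a *$\zeta$-family* is a sequence $B_0,B_1,\ldots$ of pairwise distinct sets, each a union of $\zeta$-classes, with $\{(k,x):x\in B_k\}$ r.e. A *text* is a map $T:\mathbb N\to\mathbb N\cup\{\#\}$; it is a text for $L\subseteq\mathbb N$ if the set of numbers occurring in $T$ is $L$; $T[n]$ denotes $T(0),\ldots,T(n-1)$. A *learner* is a recursive function $M:(\mathbb N\cup\{\#\})^*\to\mathbb N\cup\{?\}$. Let $W_0,W_1,\ldots$ be a fixed acceptable numbering of all r.e. sets and let $H_e$ be the $\zeta$-closure of $W_e$,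 i.e. the union of all $\zeta$-classes meeting $W_e$. The family $B_0,B_1,\ldots$ is - *confidently learnable* if some learner $M$ satisfies: for every $k$ and every text $T$ for $B_k$, there are $n,e\in\mathbb N$ with $H_e=B_k$ and $M(T[j])=e$ for all $j\ge n$; and for every text $T$ whatsoever there are $n,e\in\mathbb N$ with $M(T[j])=e$ for all $j\ge n$; - *finitely learnable* if some learner $M$ satisfies: for every $k$ and every text $T$ for $B_k$, there are $n,e\in\mathbb N$ with $H_e=B_k$, $M(T[m])={?}$ for all $m<n$, and $M(T[j])=e$ for all $j\ge n$. -/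

import Mathlib

namespace EtaLearning

/-- The `e`-th recursively enumerable set `W_e`: the domain of the `e`-th partial recursive
function in the acceptable numbering of partial recursive functions given by Mathlib's codes. -/
def W (e : ℕ) : Set ℕ :=
  {x | (Nat.Partrec.Code.eval (Denumerable.ofNat Nat.Partrec.Code e) x).Dom}

/-! ### Positive equivalence relations and families of closed sets -/

/-- A positive (that is, r.e.) equivalence relation on `ℕ` with infinitely many classes. -/
structure IsPositive (η : ℕ → ℕ → Prop) : Prop where
  equivalence : Equivalence η
  re : REPred (fun p : ℕ × ℕ => η p.1 p.2)
  infinite_classes : (Set.range fun x : ℕ => {y : ℕ | η x y}).Infinite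

/-- `L` is a union of `η`-equivalence classes. -/
def IsClosedUnder (η : ℕ → ℕ → Prop) (L : Set ℕ) : Prop :=
  ∀ x y, η x y → x ∈ L → y ∈ L

/-- The `η`-closure `[D]` of a set `D`. -/
def closureUnder (η : ℕ → ℕ → Prop) (D : Set ℕ) : Set ℕ :=
  {y | ∃ x ∈ D, η x y}

/-- An `η`-family: a one-one uniformly r.e. numbering `B 0, B 1, …` of unions of
`η`-equivalence classes. -/
structure IsFamily (η : ℕ → ℕ → Prop) (B : ℕ → Set ℕ) : Prop where
  injective : Function.Injective B
  uniformly_re : REPred (fun p : ℕ × ℕ => p.2 ∈ B p.1)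
  closed : ∀ k, IsClosedUnder η (B k)

/-! ### Texts, learners and learning criteria

The pause symbol `#` and the abstention symbol `?` are both represented by `none`. -/

/-- The content of a text: the numbers which occur in it. -/
def content (T : ℕ → Option ℕ) : Set ℕ := {x | ∃ n, T n = some x}

/-- The initial segment `T[n] = T(0), …, T(n-1)`. -/
def initSeg (T : ℕ → Option ℕ) (n : ℕ) : List (Option ℕ) := (List.range n).map T

/-- A learner `M` explanatorily learns the class `C` in the hypothesis space `H`. -/
def ExLearns (H : ℕ → Set ℕ) (M : List (Option ℕ) → Option ℕ) (C : Set (Set ℕ)) : Prop :=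
  ∀ L ∈ C, ∀ T : ℕ → Option ℕ, content T = L →
    ∃ n e, H e = L ∧ ∀ j, n ≤ j → M (initSeg T j) = some e

/-- `M` confidently learns `C`: it learns `C` explanatorily, and on every text whatsoever it
converges to some index. -/
def ConfLearns (H : ℕ → Set ℕ) (M : List (Option ℕ) → Option ℕ) (C : Set (Set ℕ)) : Prop :=
  ExLearns H M C ∧
    ∀ T : ℕ → Option ℕ, ∃ n e, ∀ j, n ≤ j → M (initSeg T j) = some e

/-- `M` finitely learns `C`: on every text for a member of `C`, it abstains up to some point, and
from then on always issues one and the same correct index. -/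
def FinLearns (H : ℕ → Set ℕ) (M : List (Option ℕ) → Option ℕ) (C : Set (Set ℕ)) : Prop :=
  ∀ L ∈ C, ∀ T : ℕ → Option ℕ, content T = L →
    ∃ n e, H e = L ∧ (∀ m, m < n → M (initSeg T m) = none) ∧
      ∀ j, n ≤ j → M (initSeg T j) = some e

/-- The hypothesis space for `η`: the `η`-closures of `W_0, W_1, …`. -/
def hypSpace (η : ℕ → ℕ → Prop) (e : ℕ) : Set ℕ := closureUnder η (W e)

/-- Some recursive learner confidently learns `C`. -/
def ConfLearnable (η : ℕ → ℕ → Prop) (C : Set (Set ℕ)) : Prop :=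
  ∃ M : List (Option ℕ) → Option ℕ, Computable M ∧ ConfLearns (hypSpace η) M C

/-- Some recursive learner finitely learns `C`. -/
def FinLearnable (η : ℕ → ℕ → Prop) (C : Set (Set ℕ)) : Prop :=
  ∃ M : List (Option ℕ) → Option ℕ, Computable M ∧ FinLearns (hypSpace η) M C

/-! ### Dense simple sets and the relation `ζ` -/

/-- The `n`-th non-element `a_n` of `Z` in ascending order, starting with `a_0`
(meaningful for all `n` when `Z` is coinfinite). -/
noncomputable def nonElement (Z : Set ℕ) (n : ℕ) : ℕ := Nat.nth (fun x => x ∉ Z) n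

/-- `Z` is dense simple: r.e., coinfinite, and the ascending enumeration of its complement
dominates every recursive function. -/
structure IsDenseSimple (Z : Set ℕ) : Prop where
  re : REPred (fun x : ℕ => x ∈ Z)
  coinfinite : Zᶜ.Infinite
  dominates : ∀ f : ℕ → ℕ, Computable f → ∃ N, ∀ n, N ≤ n → f n < nonElement Z n

/-- `x ζ y` iff `a_n ≤ min {x, y} ≤ max {x, y} < a_{n+1}` for some `n`. -/
def zeta (Z : Set ℕ) (x y : ℕ) : Prop :=
  ∃ n, nonElement Z n ≤ min x y ∧ max x y < nonElement Z (n + 1)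

end EtaLearning

/-! ### Stage approximations of r.e. predicates -/

/-! Two numbers are ζ-equivalent iff they have the same rank, the rank of x being the number of
non-elements of Z up to x. As Z is enumerated, stage ranks decrease to the true ones, and an
inequality between two stage ranks, or an upper bound on one, survives in the limit
(`rank_le_rank_of_subset`, `rank_anti`). Hence ζ is r.e., and so are the sets B_k running from the
class of k to the class of a_k.

Confident learning: the maximum of B_k has rank k + 1, so the maximum seen so far suggests k. Finite
content forces convergence because finitely many ranks stabilise. On infinite content the
suggestions grow, and since the lower end of B_k grows with k, a fixed number already seen
eventually refutes them all.

Finite learning: a finite learner commits on a computable text for B_k after N k steps, with N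
recursive. Domination, needed only here, gives an n for which all N k with k ≤ 2^n lie below a_n.
These 2^n + 1 pieces of text see only n classes, so the pieces for some j ≠ k meet the same classes
(`exists_ne_subset`). The piece for B_k then extends to a text for B_j, on which the learner is
already bound to an index of B_k (`FinLearns.eq_of_committed`). -/

open Nat.Partrec (Code) in
theorem REPred.exists_code_dom {α : Type*} [Primcodable α] {p : α → Prop} (hp : REPred p) :
    ∃ c : Code, ∀ a, p a ↔ (c.eval (Encodable.encode a)).Dom := by
  obtain ⟨c, hc⟩ := Code.exists_code.1 hp
  refine ⟨c, fun a => ?_⟩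
  rw [hc]
  simp [Part.assert]

/-- An r.e. predicate is the increasing union of uniformly primitive recursive stages. -/
theorem REPred.exists_stages {α : Type*} [Primcodable α] {p : α → Prop} (hp : REPred p) :
    ∃ S : ℕ → Set α, PrimrecRel (fun s a => a ∈ S s) ∧ Monotone S ∧
      ∀ a, p a ↔ ∃ s, a ∈ S s := by
  obtain ⟨c, hc⟩ := hp.exists_code_dom
  refine ⟨fun s => {a | (c.evaln s (Encodable.encode a)).isSome = true}, ?_, ?_, fun a => ?_⟩
  · have h : Primrec fun q : ℕ × α => (c.evaln q.1 (Encodable.encode q.2)).isSome :=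
      Primrec.option_isSome.comp (Nat.Partrec.Code.primrec_evaln.comp
        ((Primrec.fst.pair (Primrec.const c)).pair (Primrec.encode.comp Primrec.snd)))
    exact ⟨fun _ => inferInstanceAs (Decidable (_ = true)), by simpa using h⟩
  · intro s t hst a ha
    obtain ⟨v, hv⟩ := Option.isSome_iff_exists.1 (show _ = true from ha)
    exact Option.isSome_iff_exists.2 ⟨v, Nat.Partrec.Code.evaln_mono hst hv⟩
  · rw [hc, Part.dom_iff_mem]
    simp only [Nat.Partrec.Code.evaln_complete, Set.mem_ofPred_eq, Option.isSome_iff_exists,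
      Option.mem_def]
    exact exists_comm

/-- The projection of a primitive recursive relation is r.e. -/
theorem PrimrecRel.re_exists {α : Type*} [Primcodable α] {R : α → ℕ → Prop}
    (hR : PrimrecRel R) : REPred fun a => ∃ s, R a s := by
  classical
  have h : Partrec fun a => Nat.rfind fun s => Part.some (decide (R a s)) :=
    Partrec.rfind (PrimrecPred.computablePred hR).decide.partrec
  refine h.dom_re.of_eq fun a => ?_
  exact Nat.rfind_dom.trans ⟨fun ⟨n, hn, _⟩ => ⟨n, of_decide_eq_true (Part.mem_some_iff.1 hn).symm⟩,
    fun ⟨n, hn⟩ => ⟨n, Part.mem_some_iff.2 (decide_eq_true hn).symm, fun _ => trivial⟩⟩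

namespace EtaLearning

open Filter

/-! ### Ranks -/

section Rank

open scoped Classical

/-- The number of elements outside `A` which are at most `x`. -/
noncomputable def rank (A : Set ℕ) (x : ℕ) : ℕ := Nat.count (fun y => y ∉ A) (x + 1)

theorem rank_mono (A : Set ℕ) : Monotone (rank A) :=
  fun _ _ h => Nat.count_monotone _ (Nat.succ_le_succ h)

theorem rank_anti {A B : Set ℕ} (h : A ⊆ B) (x : ℕ) : rank B x ≤ rank A x :=
  Nat.count_mono_left fun _ _ hk hA => hk (h hA)

theorem rank_le (A : Set ℕ) (x : ℕ) : rank A x ≤ x + 1 := Nat.count_le _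

theorem rank_pos {A : Set ℕ} (h0 : 0 ∉ A) (x : ℕ) : 0 < rank A x :=
  Nat.pos_of_ne_zero (Nat.count_ne_iff_exists.2 ⟨0, x.succ_pos, h0⟩)

/-- The hypothesis says that no non-element of `A` lies in the interval (y, x]; enlarging `A` cannot
create one. -/
theorem rank_le_rank_of_subset {A B : Set ℕ} (h : A ⊆ B) {x y : ℕ} (hxy : rank A x ≤ rank A y) :
    rank B x ≤ rank B y := by
  by_contra! hlt
  obtain ⟨z, ⟨hz1, hz2⟩, hzB⟩ := Nat.exists_of_count_lt_count hlt
  have hzA : z ∉ A := fun hz => hzB (h hz)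
  have h1 : rank A y ≤ Nat.count (fun y => y ∉ A) z := Nat.count_monotone _ hz1
  have h2 : Nat.count (fun y => y ∉ A) z < rank A x := Nat.count_strict_mono hzA hz2
  omega

theorem lt_rank_iff {Z : Set ℕ} (hZ : Zᶜ.Infinite) {n x : ℕ} :
    n < rank Z x ↔ nonElement Z n ≤ x :=
  (Nat.lt_nth_iff_count_lt (p := fun y => y ∉ Z) hZ).trans Nat.lt_succ_iff

theorem rank_nonElement {Z : Set ℕ} (hZ : Zᶜ.Infinite) (n : ℕ) :
    rank Z (nonElement Z n) = n + 1 :=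
  Nat.count_nth_succ_of_infinite hZ n

end Rank

/-- The class between a_n and a_{n+1} is the set of numbers of rank n + 1. As 0 ∉ Z, no number has
rank 0, so these classes cover ℕ. -/
theorem zeta_iff_rank_eq {Z : Set ℕ} (hZ : Zᶜ.Infinite) (h0 : 0 ∉ Z) {x y : ℕ} :
    zeta Z x y ↔ rank Z x = rank Z y := by
  have key : ∀ n, (nonElement Z n ≤ min x y ∧ max x y < nonElement Z (n + 1)) ↔
      rank Z x = n + 1 ∧ rank Z y = n + 1 := fun n => by
    rw [le_min_iff, max_lt_iff, ← not_le, ← not_le, ← lt_rank_iff hZ, ← lt_rank_iff hZ,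
      ← lt_rank_iff hZ, ← lt_rank_iff hZ]
    omega
  simp only [zeta, key]
  have := rank_pos h0 x
  exact ⟨fun ⟨n, h⟩ => h.1.trans h.2.symm, fun h => ⟨rank Z x - 1, by omega, by omega⟩⟩

theorem eventually_rank_eq {S : ℕ → Set ℕ} {Z : Set ℕ} (hS : Monotone S)
    (hZ : ∀ x, x ∈ Z ↔ ∃ s, x ∈ S s) (x : ℕ) : ∀ᶠ s in atTop, rank (S s) x = rank Z x := by
  have h : ∀ᶠ s in atTop, ∀ y ∈ Finset.range (x + 1), (y ∈ S s ↔ y ∈ Z) := by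
    refine (Filter.eventually_all_finset _).2 fun y _ => ?_
    by_cases hy : y ∈ Z
    · obtain ⟨s, hs⟩ := (hZ y).1 hy
      filter_upwards [eventually_ge_atTop s] with t ht
      exact ⟨fun _ => hy, fun _ => hS ht hs⟩
    · exact Eventually.of_forall fun s => ⟨fun hs => (hZ y).2 ⟨s, hs⟩, fun h => absurd h hy⟩
  filter_upwards [h] with s hs
  classical
  simp only [rank, Nat.count_eq_card_filter_range]
  exact congrArg Finset.card (Finset.filter_congr fun y hy => not_congr (hs y hy))

theorem primrec_rank {S : ℕ → Set ℕ} (hS : PrimrecRel fun s x => x ∈ S s) :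
    Primrec₂ fun s x => rank (S s) x := by
  classical
  have hR : PrimrecRel fun x s => x ∉ S s := hS.not.comp Primrec.snd Primrec.fst
  have h : Primrec₂ fun s x => ((List.range (x + 1)).filter fun y => y ∉ S s).length :=
    Primrec.list_length.comp ((PrimrecRel.listFilter hR).comp
      (Primrec.list_range.comp (Primrec.succ.comp Primrec.snd)) Primrec.fst)
  refine h.of_eq fun s x => ?_
  simp only [rank, Nat.count, List.countP_eq_length_filter]

/-! ### The relation `ζ` is positive -/

theorem isPositive_zeta {Z : Set ℕ} (hZ : IsDenseSimple Z) (h0 : 0 ∉ Z) :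
    IsPositive (zeta Z) := by
  have hiff : ∀ {x y}, zeta Z x y ↔ rank Z x = rank Z y := zeta_iff_rank_eq hZ.coinfinite h0
  refine ⟨⟨fun _ => hiff.2 rfl, fun h => hiff.2 (hiff.1 h).symm,
    fun h h' => hiff.2 ((hiff.1 h).trans (hiff.1 h'))⟩, ?_, ?_⟩
  · obtain ⟨S, hSp, hS, hSZ⟩ := hZ.re.exists_stages
    have hr := primrec_rank hSp
    have h : PrimrecRel fun (p : ℕ × ℕ) s => rank (S s) p.1 = rank (S s) p.2 :=
      Primrec.eq.comp (hr.comp Primrec.snd (Primrec.fst.comp Primrec.fst))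
        (hr.comp Primrec.snd (Primrec.snd.comp Primrec.fst))
    refine h.re_exists.of_eq fun p => ?_
    rw [hiff]
    constructor
    · rintro ⟨s, hs⟩
      have hsub : S s ⊆ Z := fun x hx => (hSZ x).2 ⟨s, hx⟩
      -- Equality at a stage is two inequalities, each of which passes from `S s` to `Z`.
      exact le_antisymm (rank_le_rank_of_subset hsub hs.le) (rank_le_rank_of_subset hsub hs.ge)
    · intro h
      obtain ⟨s, h1, h2⟩ :=
        ((eventually_rank_eq hS hSZ p.1).and (eventually_rank_eq hS hSZ p.2)).exists
      exact ⟨s, by rw [h1, h2, h]⟩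
  · refine Set.infinite_of_injective_forall_mem (f := fun n => {y | zeta Z (nonElement Z n) y})
      (fun m n h => ?_) fun n => ⟨_, rfl⟩
    have h1 : nonElement Z n ∈ {y | zeta Z (nonElement Z m) y} := by
      rw [show {y | zeta Z (nonElement Z m) y} = _ from h]
      exact hiff.2 rfl
    have h2 := hiff.1 h1
    rw [rank_nonElement hZ.coinfinite, rank_nonElement hZ.coinfinite] at h2
    omega

end EtaLearning
namespace EtaLearning

open Filter

/-! ### A confidently learnable family -/

/-- If `a_n ≤ k < a_{n+1}`, this is the interval of all `y` with `a_n ≤ y < a_{k+1}`. -/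
def intervalFamily (Z : Set ℕ) (k : ℕ) : Set ℕ := {y | rank Z k ≤ rank Z y ∧ rank Z y ≤ k + 1}

theorem intervalFamily_re {Z : Set ℕ} (hZ : REPred fun x : ℕ => x ∈ Z) :
    REPred fun p : ℕ × ℕ => p.2 ∈ intervalFamily Z p.1 := by
  obtain ⟨S, hSp, hS, hSZ⟩ := hZ.exists_stages
  have hr := primrec_rank hSp
  have hr2 : Primrec₂ fun (p : ℕ × ℕ) s => rank (S s) p.2 :=
    hr.comp Primrec.snd (Primrec.snd.comp Primrec.fst)
  have h : PrimrecRel fun (p : ℕ × ℕ) s =>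
      rank (S s) p.1 ≤ rank (S s) p.2 ∧ rank (S s) p.2 ≤ p.1 + 1 :=
    PrimrecPred.and
      (Primrec.nat_le.comp (hr.comp Primrec.snd (Primrec.fst.comp Primrec.fst)) hr2)
      (Primrec.nat_le.comp hr2 (Primrec.succ.comp (Primrec.fst.comp Primrec.fst)))
  refine h.re_exists.of_eq fun p => ?_
  constructor
  · rintro ⟨s, h1, h2⟩
    have hsub : S s ⊆ Z := fun x hx => (hSZ x).2 ⟨s, hx⟩
    exact ⟨rank_le_rank_of_subset hsub h1, (rank_anti hsub _).trans h2⟩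
  · rintro ⟨h1, h2⟩
    obtain ⟨s, e1, e2⟩ :=
      ((eventually_rank_eq hS hSZ p.1).and (eventually_rank_eq hS hSZ p.2)).exists
    exact ⟨s, by rwa [e1, e2], by rwa [e2]⟩

/-- As a_k has the highest rank allowed in the k-th interval, this makes the intervals distinct and
lets k be read off from the maximum. -/
theorem nonElement_mem_intervalFamily {Z : Set ℕ} (hZ : Zᶜ.Infinite) (k : ℕ) :
    nonElement Z k ∈ intervalFamily Z k :=
  ⟨(rank_le Z k).trans (rank_nonElement hZ k).ge, (rank_nonElement hZ k).le⟩

theorem isFamily_intervalFamily {Z : Set ℕ} (hZ : IsDenseSimple Z) (h0 : 0 ∉ Z) :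
    IsFamily (zeta Z) (intervalFamily Z) where
  injective := by
    have key : ∀ j k, intervalFamily Z j = intervalFamily Z k → k ≤ j := fun j k h => by
      have h1 := nonElement_mem_intervalFamily hZ.coinfinite k
      rw [← h] at h1
      have h2 := h1.2
      rw [rank_nonElement hZ.coinfinite] at h2
      omega
    exact fun j k h => le_antisymm (key k j h.symm) (key j k h)
  uniformly_re := intervalFamily_re hZ.re
  closed k x y hxy hx := by
    have h := (zeta_iff_rank_eq hZ.coinfinite h0).1 hxy
    simpa only [intervalFamily, Set.mem_ofPred_eq, h] using hx

theorem closureUnder_eq_self {η : ℕ → ℕ → Prop} (hη : Equivalence η) {L : Set ℕ}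
    (hL : IsClosedUnder η L) : closureUnder η L = L :=
  Set.Subset.antisymm (fun y ⟨x, hx, hxy⟩ => hL x y hxy hx) fun y hy => ⟨y, hy, hη.refl y⟩

/-- Uniformly r.e. closed sets have recursively computable indices in the hypothesis space. -/
theorem IsFamily.exists_index {η : ℕ → ℕ → Prop} (hη : Equivalence η) {B : ℕ → Set ℕ}
    (hB : IsFamily η B) : ∃ e : ℕ → ℕ, Primrec e ∧ ∀ k, hypSpace η (e k) = B k := by
  obtain ⟨c, hc⟩ := hB.uniformly_re.exists_code_dom
  refine ⟨fun k => Encodable.encode (c.curry k), Primrec.encode.comp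
    (Nat.Partrec.Code.primrec₂_curry.comp (Primrec.const c) Primrec.id), fun k => ?_⟩
  have h : W (Encodable.encode (c.curry k)) = B k := by
    ext x
    rw [W, Set.mem_ofPred_eq, Denumerable.ofNat_encode, Nat.Partrec.Code.eval_curry]
    exact (hc (k, x)).symm
  rw [hypSpace, h, closureUnder_eq_self hη (hB.closed k)]

/-- The maximum of a list of numbers, or `0` if the list is empty. -/
def listMax (l : List ℕ) : ℕ := l.foldr max 0

theorem listMax_le_iff {l : List ℕ} {b : ℕ} : listMax l ≤ b ↔ ∀ y ∈ l, y ≤ b := by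
  induction l with
  | nil => simp [listMax]
  | cons a l ih => simpa [listMax] using fun _ => ih

theorem primrec_listMax : Primrec listMax :=
  Primrec.list_foldr Primrec.id (Primrec.const 0)
    (Primrec.nat_max.comp (Primrec.fst.comp Primrec.snd) (Primrec.snd.comp Primrec.snd)).to₂

/-- The numbers occurring in a finite sequence. -/
def numbers (σ : List (Option ℕ)) : List ℕ := σ.filterMap id

theorem mem_numbers_initSeg {T : ℕ → Option ℕ} {n y : ℕ} :
    y ∈ numbers (initSeg T n) ↔ ∃ i < n, T i = some y := by
  simp [numbers, initSeg]

theorem eventually_mem_numbers {T : ℕ → Option ℕ} {y : ℕ} (hy : y ∈ content T) :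
    ∀ᶠ n in atTop, y ∈ numbers (initSeg T n) := by
  obtain ⟨i, hi⟩ := hy
  filter_upwards [eventually_gt_atTop i] with n hn
  exact mem_numbers_initSeg.2 ⟨i, hn, hi⟩

theorem content_of_mem_numbers {T : ℕ → Option ℕ} {n y : ℕ} (h : y ∈ numbers (initSeg T n)) :
    y ∈ content T :=
  let ⟨i, _, hi⟩ := mem_numbers_initSeg.1 h
  ⟨i, hi⟩

/-- The guess at the position of the set being presented in the family of intervals, where `A`
approximates `Z` from below. -/
noncomputable def guess (A : Set ℕ) (l : List ℕ) : ℕ := rank A (listMax l) - 1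

open Classical in
/-- The learner for the family of intervals, with `e` computing indices and `S` approximating `Z`.
It rejects guesses whose class lies above some number already seen. -/
noncomputable def intervalLearner (S : ℕ → Set ℕ) (e : ℕ → ℕ) (σ : List (Option ℕ)) : Option ℕ :=
  if ∀ y ∈ numbers σ, rank (S σ.length) (guess (S σ.length) (numbers σ)) ≤ rank (S σ.length) y
  then some (e (guess (S σ.length) (numbers σ))) else some (e 0)

theorem primrec_intervalLearner {S : ℕ → Set ℕ} (hS : PrimrecRel fun s x => x ∈ S s) {e : ℕ → ℕ}
    (he : Primrec e) : Primrec (intervalLearner S e) := by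
  have hr := primrec_rank hS
  have hnum : Primrec numbers := Primrec.listFilterMap Primrec.id Primrec.snd
  have hg : Primrec fun σ : List (Option ℕ) => guess (S σ.length) (numbers σ) :=
    Primrec.nat_sub.comp (hr.comp Primrec.list_length (primrec_listMax.comp hnum))
      (Primrec.const 1)
  have hrel : PrimrecRel fun (y : ℕ) (p : ℕ × ℕ) => rank (S p.1) p.2 ≤ rank (S p.1) y :=
    Primrec.nat_le.comp
      (hr.comp (Primrec.fst.comp Primrec.snd) (Primrec.snd.comp Primrec.snd))
      (hr.comp (Primrec.fst.comp Primrec.snd) Primrec.fst)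
  have hc := hrel.forall_mem_list.comp hnum (Primrec.list_length.pair hg)
  exact Primrec.ite hc (Primrec.option_some.comp (he.comp hg)) (Primrec.const _)

theorem length_initSeg (T : ℕ → Option ℕ) (n : ℕ) : (initSeg T n).length = n := by
  simp [initSeg]

theorem intervalLearner_initSeg (S : ℕ → Set ℕ) (e : ℕ → ℕ) (T : ℕ → Option ℕ) (n : ℕ)
    {l : List ℕ} (hl : numbers (initSeg T n) = l) {k : ℕ} (hk : guess (S n) l = k) :
    ((∀ y ∈ l, rank (S n) k ≤ rank (S n) y) → intervalLearner S e (initSeg T n) = some (e k)) ∧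
    ((¬ ∀ y ∈ l, rank (S n) k ≤ rank (S n) y) →
      intervalLearner S e (initSeg T n) = some (e 0)) := by
  subst hl hk
  simp only [intervalLearner, length_initSeg]
  exact ⟨fun h => if_pos h, fun h => if_neg h⟩

/-! ### Convergence of the interval learner on arbitrary texts -/

section Convergence

variable {S : ℕ → Set ℕ} {Z : Set ℕ}

/-- On a text with finite content, the learner converges to the output computed from `Z` itself. -/
theorem intervalLearner_of_finite (hS : Monotone S) (hSZ : ∀ x, x ∈ Z ↔ ∃ s, x ∈ S s)
    (e : ℕ → ℕ) {T : ℕ → Option ℕ} (hT : (content T).Finite) :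
    ∃ x, (∀ b, x ≤ b ↔ ∀ y ∈ content T, y ≤ b) ∧ ∀ᶠ n in atTop,
      ((∀ y ∈ content T, rank Z (rank Z x - 1) ≤ rank Z y) →
        intervalLearner S e (initSeg T n) = some (e (rank Z x - 1))) ∧
      ((¬ ∀ y ∈ content T, rank Z (rank Z x - 1) ≤ rank Z y) →
        intervalLearner S e (initSeg T n) = some (e 0)) := by
  have hmem : ∀ᶠ n in atTop, ∀ y, y ∈ numbers (initSeg T n) ↔ y ∈ content T := by
    filter_upwards [(Filter.eventually_all_finite hT).2 fun y hy => eventually_mem_numbers hy]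
      with n hn y
    exact ⟨content_of_mem_numbers, hn y⟩
  obtain ⟨n₀, hn₀⟩ := hmem.exists
  -- Describing the maximum as a least upper bound includes the empty content, where it is 0.
  have hmax : ∀ b, listMax (numbers (initSeg T n₀)) ≤ b ↔ ∀ y ∈ content T, y ≤ b := fun b => by
    simp only [listMax_le_iff, hn₀]
  refine ⟨_, hmax, ?_⟩
  set x := listMax (numbers (initSeg T n₀))
  filter_upwards [hmem, eventually_rank_eq hS hSZ x, eventually_rank_eq hS hSZ (rank Z x - 1),
    (Filter.eventually_all_finite hT).2 fun y _ => eventually_rank_eq hS hSZ y]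
    with n h1 h2 h3 h4
  have hx : listMax (numbers (initSeg T n)) = x := by
    refine eq_of_forall_ge_iff fun b => ?_
    simp only [hmax, listMax_le_iff, h1]
  have h := intervalLearner_initSeg S e T n rfl (k := rank Z x - 1) (by rw [guess, hx, h2])
  have hiff : (∀ y ∈ numbers (initSeg T n), rank (S n) (rank Z x - 1) ≤ rank (S n) y) ↔
      ∀ y ∈ content T, rank Z (rank Z x - 1) ≤ rank Z y := by
    simp only [h1, h3]
    exact forall₂_congr fun y hy => by rw [h4 y hy]
  rwa [hiff] at h

/-- On a text with infinite content, the learner finally rejects all guesses. -/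
theorem intervalLearner_of_infinite (hZ : Zᶜ.Infinite) (hSZ : ∀ x, x ∈ Z ↔ ∃ s, x ∈ S s)
    (e : ℕ → ℕ) {T : ℕ → Option ℕ} (hT : (content T).Infinite) :
    ∀ᶠ n in atTop, intervalLearner S e (initSeg T n) = some (e 0) := by
  obtain ⟨y₀, hy₀⟩ := hT.nonempty
  -- Once x₀ is seen, the guess is at least a_{y₀+1}, so its rank exceeds y₀ + 1, which bounds the
  -- rank of y₀ at every stage. Thus y₀ refutes the guess even if the stage ranks have not settled.
  obtain ⟨x₀, hx₀, hlt⟩ := hT.exists_gt (nonElement Z (nonElement Z (y₀ + 1)))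
  filter_upwards [eventually_mem_numbers hy₀, eventually_mem_numbers hx₀] with n h1 h2
  refine (intervalLearner_initSeg S e T n rfl rfl).2 fun h => ?_
  have hsub : S n ⊆ Z := fun x hx => (hSZ x).2 ⟨n, hx⟩
  have hle : x₀ ≤ listMax (numbers (initSeg T n)) := listMax_le_iff.1 le_rfl _ h2
  have hk : nonElement Z (y₀ + 1) ≤ guess (S n) (numbers (initSeg T n)) := by
    have h3 : nonElement Z (y₀ + 1) < rank Z (listMax (numbers (initSeg T n))) :=
      (lt_rank_iff hZ).2 (hlt.le.trans hle)
    have h4 := rank_anti hsub (listMax (numbers (initSeg T n)))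
    rw [guess]
    omega
  have h5 := (lt_rank_iff hZ).2 hk
  have h6 := rank_anti hsub (guess (S n) (numbers (initSeg T n)))
  have h7 := h y₀ h1
  have h8 := rank_le (S n) y₀
  omega

end Convergence

theorem exists_confLearnable_family {Z : Set ℕ} (hZ : IsDenseSimple Z) (h0 : 0 ∉ Z) :
    ∃ B : ℕ → Set ℕ, IsFamily (zeta Z) B ∧ ConfLearnable (zeta Z) (Set.range B) := by
  have hB := isFamily_intervalFamily hZ h0
  obtain ⟨e, hep, he⟩ := hB.exists_index (isPositive_zeta hZ h0).equivalence
  obtain ⟨S, hSp, hS, hSZ⟩ := hZ.re.exists_stages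
  refine ⟨_, hB, intervalLearner S e, (primrec_intervalLearner hSp hep).to_comp, ?_, fun T => ?_⟩
  · rintro _ ⟨k, rfl⟩ T hT
    have hlt : ∀ y ∈ intervalFamily Z k, y < nonElement Z (k + 1) := fun y hy => by
      have h1 := hy.2
      contrapose! h1
      exact (lt_rank_iff hZ.coinfinite).2 h1
    have hfin : (content T).Finite := hT ▸ (Set.finite_lt_nat _).subset hlt
    obtain ⟨x, hx, hev⟩ := intervalLearner_of_finite hS hSZ e hfin
    have hmem := nonElement_mem_intervalFamily hZ.coinfinite k
    have hxk : rank Z x = k + 1 := by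
      refine le_antisymm ?_ ?_
      · have h1 : x ≤ nonElement Z (k + 1) - 1 :=
          (hx _).2 fun y hy => Nat.le_sub_one_of_lt (hlt y (hT ▸ hy))
        have h2 := hlt _ hmem
        by_contra! h3
        have h4 := (lt_rank_iff hZ.coinfinite).1 h3
        omega
      · exact (lt_rank_iff hZ.coinfinite).2 ((hx x).1 le_rfl _ (hT ▸ hmem))
    rw [hxk, Nat.add_sub_cancel, hT] at hev
    obtain ⟨n, hn⟩ := eventually_atTop.1 hev
    -- The rejection test is the lower bound in the definition of the interval, so the correct guess
    -- passes it.
    exact ⟨n, e k, he k, fun j hj => (hn j hj).1 fun y hy => hy.1⟩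
  · suffices h : ∃ i, ∀ᶠ j in atTop, intervalLearner S e (initSeg T j) = some i by
      obtain ⟨i, hi⟩ := h
      obtain ⟨n, hn⟩ := eventually_atTop.1 hi
      exact ⟨n, i, hn⟩
    by_cases hT : (content T).Finite
    · obtain ⟨x, -, hev⟩ := intervalLearner_of_finite hS hSZ e hT
      by_cases hc : ∀ y ∈ content T, rank Z (rank Z x - 1) ≤ rank Z y
      · exact ⟨_, hev.mono fun n hn => hn.1 hc⟩
      · exact ⟨_, hev.mono fun n hn => hn.2 hc⟩
    · exact ⟨_, intervalLearner_of_infinite hZ.coinfinite hSZ e hT⟩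

end EtaLearning
namespace EtaLearning

/-! ### No family is finitely learnable -/

/-- The members of a family have uniformly computable texts in which every number occurs at a
position not below it. -/
theorem exists_texts {B : ℕ → Set ℕ} (hB : REPred fun p : ℕ × ℕ => p.2 ∈ B p.1) :
    ∃ T : ℕ → ℕ → Option ℕ, Primrec₂ T ∧ (∀ k, content (T k) = B k) ∧
      ∀ k i x, T k i = some x → x ≤ i := by
  classical
  obtain ⟨S, hSp, -, hS⟩ := hB.exists_stages
  have hle : ∀ k i x : ℕ, (if (k, i.unpair.2) ∈ S i.unpair.1 then some i.unpair.2 else none) =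
      some x → x ≤ i := fun k i x h => by
    split_ifs at h
    cases h
    exact Nat.unpair_right_le i
  -- Position ⟨s, x⟩ shows x if x has entered by stage s; the bound is x ≤ ⟨s, x⟩.
  refine ⟨fun k i => if (k, i.unpair.2) ∈ S i.unpair.1 then some i.unpair.2 else none,
    ?_, fun k => ?_, hle⟩
  · have hu : Primrec fun p : ℕ × ℕ => p.2.unpair := Primrec.unpair.comp Primrec.snd
    have h1 := Primrec.fst.comp hu
    have h2 := Primrec.snd.comp hu
    exact Primrec.ite (hSp.comp h1 (Primrec.fst.pair h2)) (Primrec.option_some.comp h2)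
      (Primrec.const none)
  · ext x
    rw [hS (k, x)]
    constructor
    · rintro ⟨i, hi⟩
      dsimp only at hi
      split_ifs at hi with h
      cases hi
      exact ⟨_, h⟩
    · rintro ⟨s, hs⟩
      exact ⟨Nat.pair s x, by simp [hs]⟩

/-- Prolonging the initial segment `T[n]` by the text `T'`. -/
def prolong (T : ℕ → Option ℕ) (n : ℕ) (T' : ℕ → Option ℕ) (i : ℕ) : Option ℕ :=
  if i < n then T i else T' (i - n)

theorem initSeg_prolong (T : ℕ → Option ℕ) (n : ℕ) (T' : ℕ → Option ℕ) :
    initSeg (prolong T n T') n = initSeg T n :=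
  List.map_congr_left fun _ hi => if_pos (List.mem_range.1 hi)

theorem content_prolong {T : ℕ → Option ℕ} {n : ℕ} {T' : ℕ → Option ℕ}
    (h : ∀ i < n, ∀ x, T i = some x → x ∈ content T') :
    content (prolong T n T') = content T' := by
  ext x
  constructor
  · rintro ⟨i, hi⟩
    rw [prolong] at hi
    split_ifs at hi with hin
    · exact h i hin x hi
    · exact ⟨_, hi⟩
  · rintro ⟨i, hi⟩
    exact ⟨n + i, by simp [prolong, hi]⟩

/-- If `M` finitely learns `C`, then the content of an initial segment of a text for `L ∈ C` on
which `M` commits itself is contained in no other member of `C`. -/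
theorem FinLearns.eq_of_committed {H : ℕ → Set ℕ} {M : List (Option ℕ) → Option ℕ}
    {C : Set (Set ℕ)} (hM : FinLearns H M C) {T T' : ℕ → Option ℕ} (hT : content T ∈ C)
    (hT' : content T' ∈ C) {n : ℕ} (hn : M (initSeg T n) ≠ none)
    (h : ∀ i < n, ∀ x, T i = some x → x ∈ content T') : content T = content T' := by
  -- A first commitment is final, hence already correct on every text for a member of `C` that
  -- begins with this segment.
  have key : ∀ U, content U ∈ C → M (initSeg U n) ≠ none →
      ∃ e, H e = content U ∧ M (initSeg U n) = some e := fun U hU hne => by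
    obtain ⟨m, e, he, h1, h2⟩ := hM _ hU U rfl
    exact ⟨e, he, h2 n (not_lt.1 fun hlt => hne (h1 n hlt))⟩
  have hc := content_prolong h
  obtain ⟨e, he, h1⟩ := key T hT hn
  obtain ⟨e', he', h2⟩ := key (prolong T n T') (hc ▸ hT') (by rwa [initSeg_prolong])
  rw [initSeg_prolong, h1, Option.some_inj] at h2
  rw [← he, h2, he', hc]

theorem _root_.Computable.sum_range {f : ℕ → ℕ} (hf : Computable f) :
    Computable fun n => ∑ k ∈ Finset.range n, f k := by
  have h : Computable fun n : ℕ =>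
      (Nat.rec 0 (fun k acc => acc + f k) n : ℕ) :=
    Computable.nat_rec Computable.id (Computable.const 0)
      (Primrec.nat_add.to_comp.comp (Computable.snd.comp Computable.snd)
        (hf.comp (Computable.fst.comp Computable.snd))).to₂
  refine h.of_eq fun n => ?_
  induction n with
  | zero => rfl
  | succ n ih => rw [Finset.sum_range_succ, ← ih]

theorem _root_.Primrec.two_pow : Primrec fun n : ℕ => 2 ^ n := by
  have h : Primrec fun n : ℕ => (Nat.rec 1 (fun _ acc => acc * 2) n : ℕ) :=
    Primrec.nat_rec₁ 1 (Primrec.nat_mul.comp Primrec.snd (Primrec.const 2))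
  refine h.of_eq fun n => ?_
  induction n with
  | zero => rfl
  | succ n ih => rw [pow_succ, ← ih]

/-- There are at most `2 ^ n` unions of `ζ`-classes that can be told apart below `a_n`. -/
theorem exists_ne_subset {Z : Set ℕ} (hZ : Zᶜ.Infinite) (h0 : 0 ∉ Z) {B D : ℕ → Set ℕ}
    (hB : ∀ k, IsClosedUnder (zeta Z) (B k)) (hD : ∀ k, D k ⊆ B k) {n : ℕ}
    (hn : ∀ k ≤ 2 ^ n, ∀ x ∈ D k, x < nonElement Z n) : ∃ j k, j ≠ k ∧ D k ⊆ B j := by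
  classical
  -- Numbers below a_n have ranks 1, …, n, so `g k` records exactly which classes `D k` meets
  -- whenever k ≤ 2^n.
  let g : ℕ → Finset ℕ := fun k => {r ∈ Finset.Icc 1 n | ∃ x ∈ D k, rank Z x = r}
  obtain ⟨j, -, k, hk, hjk, hg⟩ := Finset.exists_ne_map_eq_of_card_lt_of_maps_to
    (s := Finset.range (2 ^ n + 1)) (t := (Finset.Icc 1 n).powerset) (f := g) (by simp)
    fun k _ => Finset.mem_powerset.2 (Finset.filter_subset _ _)
  refine ⟨j, k, hjk, fun x hx => ?_⟩
  have hlt := hn k (Nat.lt_succ_iff.1 (Finset.mem_range.1 hk)) x hx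
  have hr : rank Z x ∈ g k := Finset.mem_filter.2
    ⟨Finset.mem_Icc.2 ⟨rank_pos h0 x, not_lt.1 fun h => hlt.not_ge ((lt_rank_iff hZ).1 h)⟩,
      x, hx, rfl⟩
  rw [← hg] at hr
  obtain ⟨y, hy, hyx⟩ := (Finset.mem_filter.1 hr).2
  exact hB j y x ((zeta_iff_rank_eq hZ h0).2 hyx) (hD j hy)

theorem not_finLearnable {Z : Set ℕ} (hZ : IsDenseSimple Z) (h0 : 0 ∉ Z) {B : ℕ → Set ℕ}
    (hB : IsFamily (zeta Z) B) : ¬ FinLearnable (zeta Z) (Set.range B) := by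
  rintro ⟨M, hMc, hM⟩
  obtain ⟨T, hTp, hT, hTle⟩ := exists_texts hB.uniformly_re
  have hTB : ∀ k, content (T k) ∈ Set.range B := fun k => ⟨k, (hT k).symm⟩
  have hex : ∀ k, ∃ n, (M (initSeg (T k) n)).isSome = true := fun k => by
    obtain ⟨n, e, -, -, h⟩ := hM _ (hTB k) (T k) rfl
    exact ⟨n, by simp [h n le_rfl]⟩
  have hseg : Primrec fun p : ℕ × ℕ => initSeg (T p.1) p.2 :=
    Primrec.list_map (Primrec.list_range.comp Primrec.snd)
      (hTp.comp (Primrec.fst.comp Primrec.fst) Primrec.snd)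
  have hcomp : ComputablePred fun p : ℕ × ℕ => (M (initSeg (T p.1) p.2)).isSome = true :=
    Computable.computablePred <| by
      simpa using Primrec.option_isSome.to_comp.comp (hMc.comp hseg.to_comp)
  have hN := Computable.find (P := fun k n => (M (initSeg (T k) n)).isSome = true) hcomp hex
  set N : ℕ → ℕ := fun k => Nat.find (hex k)
  -- The sum of N k over k ≤ 2^n is a recursive function of n bounding all these N k at once; by
  -- `hTle` it also bounds the numbers shown before commitment.
  obtain ⟨n, hn⟩ := hZ.dominates _ (hN.sum_range.comp
    (Primrec.succ.to_comp.comp Primrec.two_pow.to_comp))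
  obtain ⟨j, k, hjk, hsub⟩ := exists_ne_subset hZ.coinfinite h0 hB.closed
    (D := fun k => {x | ∃ i < N k, T k i = some x}) (n := n)
    (fun k x ⟨i, _, hi⟩ => hT k ▸ ⟨i, hi⟩)
    (fun k hk x ⟨i, hi, hix⟩ => by
      have h1 : N k ≤ ∑ i ∈ Finset.range (2 ^ n + 1), N i :=
        Finset.single_le_sum (fun _ _ => Nat.zero_le _)
          (Finset.mem_range.2 (Nat.lt_succ_of_le hk))
      exact ((hTle k i x hix).trans_lt hi).trans_le (h1.trans (hn n le_rfl).le))
  have h := hM.eq_of_committed (hTB k) (hTB j) (n := N k)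
    (Option.isSome_iff_ne_none.1 (Nat.find_spec (hex k)))
    fun i hi x hx => (hT j).symm ▸ hsub ⟨i, hi, hx⟩
  rw [hT, hT] at h
  exact hjk (hB.injective h.symm)

end EtaLearning
open EtaLearning in
theorem theorem6p3 (Z : Set ℕ) (hZ : IsDenseSimple Z) (h0 : 0 ∉ Z) :
    IsPositive (zeta Z) ∧
    (∃ B : ℕ → Set ℕ, IsFamily (zeta Z) B ∧ ConfLearnable (zeta Z) (Set.range B)) ∧
    (∀ B : ℕ → Set ℕ, IsFamily (zeta Z) B → ¬ FinLearnable (zeta Z) (Set.range B)) :=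
  ⟨isPositive_zeta hZ h0, exists_confLearnable_family hZ h0, fun _ hB =>
    not_finLearnable hZ h0 hB⟩
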